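/- Let $c_1,\dots,c_{2n}$ be the Majorana operators on $\mathcal H=(\mathbb C^2)^{\otimes n}$, i.e. $c_{2j-1}=Z^{\otimes(j-1)}\otimes X\otimes I^{\otimes(n-j)}$ and $c_{2j}=Z^{\otimes(j-1)}\otimes Y\otimes I^{\otimes(n-j)}$ for $1\le j\le n$. For $0\le\kappa\le 2n$ let $\mathcal B_\kappa$ be the complex span of the products of $\kappa$ distinct Majorana operators, let $M_\kappa$ be the orthogonal projection of an operator $M$ onto $\mathcal B_\kappa$ with respect to the Hilbert–Schmidt inner product, and let $\mathcal P_\kappa(M)=\mathrm{Tr}[M_\kappa^\dagger M_\kappa]$ be the $\kappa$-purity of $M$. Let $U(\vec\theta)=\prod_l e^{-i\theta_l H_l}$ be a parametrized matchgate circuit, with every $H_l$ in $\mathcal G=\{Z_i\}_{i=1}^{n}\cup\{X_iX_{i+1}\}_{i=1}^{n-1}$, and let $\vec\theta$ be drawn from a probability distribution for which $U(\vec\theta)$ forms a $2$-design over the compact Lie group $G=e^{\mathfrak g}$, where $\mathfrak g$ is the real Lie algebra generated by $i\mathcal G$. That is, for $t=1,2$ and every operator $A$ on $\mathcal H^{\otimes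 t}$, $\mathbb E_{\vec\theta}[U(\vec\theta)^{\otimes t}A\,U^\dagger(\vec\theta)^{\otimes t}]=\int_G U^{\otimes t}A\,(U^\dagger)^{\otimes t}\,dU$, where $dU$ is the normalized Haar measure on $G$. Let $\rho$ be an $n$-qubit state and let $O$ be a Hermitian operator with $O\in\mathcal B_\kappa$, where $1\le\kappa\le 2n-1$ and $\kappa\neq n$. Then the loss $\ell_{\vec\theta}(\rho,O)=\mathrm{Tr}[U(\vec\theta)\rho U^\dagger(\vec\theta)O]$ satisfies $$\mathrm{Var}_{\vec\theta}[\ell_{\vec\theta}(\rho,O)]=\frac{\mathcal P_\kappa(\rho)\,\mathcal P_\kappa(O)}{\dim(\mathcal B_\kappa)},\qquad \dim(\mathcal B_\kappa)=\binom{2n}{\kappa}.$$ -/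

import Mathlib

open MeasureTheory ProbabilityTheory Matrix
open scoped Kronecker ComplexOrder

namespace Matchgate

/-- Computational-basis labels of `n` qubits; operators on `(ℂ²)^{⊗ n}` are `2^n × 2^n` complex
matrices indexed by them. -/
abbrev Basis (n : ℕ) : Type := Fin n → Fin 2

/-- The space `𝓑` of linear operators on `n` qubits. -/
abbrev Op (n : ℕ) : Type := Matrix (Basis n) (Basis n) ℂ

/-- The Pauli matrix `X`. -/
def pauliX : Matrix (Fin 2) (Fin 2) ℂ := !![0, 1; 1, 0]

/-- The Pauli matrix `Y`. -/
def pauliY : Matrix (Fin 2) (Fin 2) ℂ := !![0, -Complex.I; Complex.I, 0]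

/-- The Pauli matrix `Z`. -/
def pauliZ : Matrix (Fin 2) (Fin 2) ℂ := !![1, 0; 0, -1]

/-- The tensor product `A 0 ⊗ A 1 ⊗ ⋯ ⊗ A (n-1)` of single-qubit operators. -/
def tensorOp {n : ℕ} (A : Fin n → Matrix (Fin 2) (Fin 2) ℂ) : Op n :=
  Matrix.of fun x y => ∏ k, A k (x k) (y k)

/-- `Z` acting on qubit `i`. -/
def zAt {n : ℕ} (i : Fin n) : Op n :=
  tensorOp fun k => if k = i then pauliZ else 1

/-- `X ⊗ X` acting on qubits `i` and `j`. -/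
def xxAt {n : ℕ} (i j : Fin n) : Op n :=
  tensorOp fun k => if k = i ∨ k = j then pauliX else 1

/-- The set of circuit generators `{Z_i}_{1 ≤ i ≤ n} ∪ {X_i X_{i+1}}_{1 ≤ i ≤ n-1}`. -/
def generators (n : ℕ) : Set (Op n) :=
  {H | ∃ i : Fin n, H = zAt i} ∪ {H | ∃ i j : Fin n, (i : ℕ) + 1 = j ∧ H = xxAt i j}

-- The Lie bracket on operators is the commutator `A * B - B * A`.
attribute [local instance 100] LieRing.ofAssociativeRing

/-- The dynamical Lie algebra `𝔤`: the real Lie algebra generated by `i` times the generators,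
for the commutator bracket. -/
noncomputable def dla (n : ℕ) : LieSubalgebra ℝ (Op n) :=
  LieSubalgebra.lieSpan ℝ (Op n) {A | ∃ H ∈ generators n, A = Complex.I • H}

/-- The set of exponentials of elements of `𝔤` (which are skew-Hermitian matrices), as unitaries. -/
def expSet (n : ℕ) : Set (Matrix.unitaryGroup (Basis n) ℂ) :=
  {U | ∃ A ∈ dla n, (U : Op n) = NormedSpace.exp A}

/-- The compact Lie group `G = e^𝔤`, as a subgroup of the unitary group: the closed subgroup
generated by the exponentials of the elements of `𝔤`. (These are exactly the exponentials
themselves: `e^𝔤` is a compact connected group, a copy of `Spin(2n)` when `n ≥ 2`, so that neither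
generating a group nor taking the closure adds anything.) -/
noncomputable def matchgateGroup (n : ℕ) : Subgroup (Matrix.unitaryGroup (Basis n) ℂ) :=
  (Subgroup.closure (expSet n)).topologicalClosure

theorem isCompact_unitaryGroup (n : ℕ) :
    IsCompact (Matrix.unitaryGroup (Basis n) ℂ : Set (Op n)) := by
  have hK : IsCompact (Set.univ.pi fun _ : Basis n => Set.univ.pi fun _ : Basis n =>
      Metric.closedBall (0 : ℂ) 1) :=
    isCompact_univ_pi fun _ => isCompact_univ_pi fun _ => isCompact_closedBall 0 1
  refine IsCompact.of_isClosed_subset (X := Basis n → Basis n → ℂ) hK ?_ ?_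
  · exact isClosed_unitary (R := Op n)
  · intro U hU i _ j _
    simpa using entry_norm_bound_of_unitary hU i j

instance (n : ℕ) : CompactSpace (Matrix.unitaryGroup (Basis n) ℂ) :=
  isCompact_iff_compactSpace.mp (isCompact_unitaryGroup n)

instance (n : ℕ) : CompactSpace (matchgateGroup n) :=
  isCompact_iff_compactSpace.mp
    (Subgroup.isClosed_topologicalClosure
      (Subgroup.closure (expSet n))).isCompact

/-- The Borel `σ`-algebra of `G`. -/
noncomputable instance (n : ℕ) : MeasurableSpace (matchgateGroup n) := borel _

instance (n : ℕ) : BorelSpace (matchgateGroup n) := ⟨rfl⟩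

/-- The normalized Haar measure `dU` of the compact group `G`: total mass one. -/
noncomputable def haarG (n : ℕ) : Measure (matchgateGroup n) :=
  Measure.haarMeasure ⊤

/-- The Majorana operators `c_1 = X I ⋯ I`, `c_2 = Y I ⋯ I`, `c_3 = Z X I ⋯ I`,
`c_4 = Z Y I ⋯ I`, …, `c_{2n} = Z ⋯ Z Y`, with the index shifted to start at `0`. -/
def majorana (n : ℕ) (μ : Fin (2 * n)) : Op n :=
  tensorOp fun k : Fin n =>
    if (k : ℕ) < (μ : ℕ) / 2 then pauliZ
    else if (k : ℕ) = (μ : ℕ) / 2 then (if (μ : ℕ) % 2 = 0 then pauliX else pauliY)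
    else 1

/-- The product `c^s = c_{ν_1} ⋯ c_{ν_κ}`, where `ν_1 < ⋯ < ν_κ` are the elements of `s`. -/
def majoranaProd (n : ℕ) (s : Finset (Fin (2 * n))) : Op n :=
  (s.sort.map (majorana n)).prod

/-- The module `𝓑_κ`: the complex span of the products of `κ` distinct Majorana operators. -/
def majoranaModule (n κ : ℕ) : Submodule ℂ (Op n) :=
  Submodule.span ℂ {A | ∃ s : Finset (Fin (2 * n)), s.card = κ ∧ A = majoranaProd n s}

/-- The orthogonal projection `M_κ = ∑_j Tr[B_j† M] B_j` of `M` onto `𝓑_κ` for the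
Hilbert–Schmidt inner product, where `B_j` runs over the orthonormal basis `c^s / √(2^n)`,
`|s| = κ`. (A phase that makes each `B_j` Hermitian cancels.) -/
noncomputable def component {n : ℕ} (κ : ℕ) (M : Op n) : Op n :=
  ∑ s ∈ Finset.powersetCard κ (Finset.univ : Finset (Fin (2 * n))),
    (((2 : ℂ) ^ n)⁻¹ * ((majoranaProd n s)ᴴ * M).trace) • majoranaProd n s

/-- The `κ`-purity `𝓟_κ(M) = Tr[M_κ† M_κ]` (a nonnegative real number). -/
noncomputable def purity {n : ℕ} (κ : ℕ) (M : Op n) : ℝ :=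
  ((component κ M)ᴴ * component κ M).trace.re

/-- `ρ` is an `n`-qubit state (density operator). -/
def IsState {n : ℕ} (ρ : Op n) : Prop := ρ.PosSemidef ∧ ρ.trace = 1

/-- The parametrized circuit `U(θ) = ∏_l e^{-i θ_l H_l}`. -/
noncomputable def circuit {n L : ℕ} (H : Fin L → Op n) (θ : Fin L → ℝ) : Op n :=
  (List.ofFn fun l => NormedSpace.exp (-(Complex.I * (θ l : ℂ)) • H l)).prod

/-- The loss `Tr[U ρ U† O]` (a real number when `ρ` and `O` are Hermitian). -/
noncomputable def loss {n : ℕ} (ρ O U : Op n) : ℝ := (U * ρ * Uᴴ * O).trace.re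

/-- The random operator `U θ`, `θ ∼ μ`, is a `2`-design over `G`: for `t = 1, 2` the averages of
`U^{⊗ t} A (U†)^{⊗ t}` over `θ` and over the Haar measure of `G` agree for all operators `A`.
Integrals of matrices are taken entrywise. -/
def IsTwoDesign {n : ℕ} {Θ : Type*} [MeasurableSpace Θ] (μ : Measure Θ) (U : Θ → Op n) : Prop :=
  (∀ (A : Op n) (i j : Basis n),
    ∫ θ, (U θ * A * (U θ)ᴴ) i j ∂μ
      = ∫ g : matchgateGroup n, ((g : Op n) * A * (g : Op n)ᴴ) i j ∂(haarG n)) ∧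
  (∀ (A : Matrix (Basis n × Basis n) (Basis n × Basis n) ℂ) (i j : Basis n × Basis n),
    ∫ θ, ((U θ ⊗ₖ U θ) * A * (U θ ⊗ₖ U θ)ᴴ) i j ∂μ
      = ∫ g : matchgateGroup n,
          (((g : Op n) ⊗ₖ (g : Op n)) * A * ((g : Op n) ⊗ₖ (g : Op n))ᴴ) i j ∂(haarG n))

end Matchgate

/-! The design hypothesis replaces the first two moments of the loss by integrals over $G$, and
these follow from a few symmetries, with no description of the commutant. Expand $O=\sum_s a_s c^s$
over subsets $s$ of size $\kappa$. The mean is linear in the Haar means of the $c^s$, and the second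
moment is $\sum_{s,t}\bar a_s a_t F(s,t)$ with $F(s,t)$ = `haarForm` of $c^s,c^t$.

For adjacent $\mu,\nu$, $G$ contains the half turn $c_\mu c_\nu$, which under conjugation negates
$c^s$ exactly when $s$ separates $\mu$ from $\nu$. A nonempty proper $s$ separates some adjacent
pair, so the mean is zero. For $s\ne t$, $F(s,t)=0$ unless $s\mathbin{\triangle}t$ is everything;
then $t=s^c$ and $\kappa=n$, which is excluded.

The quarter turn $(1+c_\mu c_\nu)/\sqrt2$ permutes the $c^s$, up to sign, by the transposition
$(\mu\,\nu)$. Adjacent transpositions act transitively on subsets of size $\kappa$, so all $F(s,s)$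
agree. Their sum is the integral of $2^n\mathcal P_\kappa(g\rho g^\dagger)$, which is constant
because $G$ preserves $\mathcal B_\kappa$. Hence $F(s,s)=2^n\mathcal
P_\kappa(\rho)/\binom{2n}{\kappa}$, and Parseval, $2^n\sum_s|a_s|^2=\mathcal P_\kappa(O)$, finishes
(`choose_mul_haarForm`). -/

namespace Matchgate

/-! ### Pauli matrices and tensor products -/

section Pauli

@[simp] lemma pauliX_mul_self : pauliX * pauliX = 1 := by
  ext i j; fin_cases i <;> fin_cases j <;> simp [pauliX, Matrix.mul_apply]

@[simp] lemma pauliY_mul_self : pauliY * pauliY = 1 := by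
  ext i j; fin_cases i <;> fin_cases j <;> simp [pauliY, Matrix.mul_apply]

@[simp] lemma pauliZ_mul_self : pauliZ * pauliZ = 1 := by
  ext i j; fin_cases i <;> fin_cases j <;> simp [pauliZ, Matrix.mul_apply]

lemma pauliX_mul_pauliY : pauliX * pauliY = Complex.I • pauliZ := by
  ext i j; fin_cases i <;> fin_cases j <;> simp [pauliX, pauliY, pauliZ, Matrix.mul_apply]

lemma pauliY_mul_pauliX : pauliY * pauliX = -(Complex.I • pauliZ) := by
  ext i j; fin_cases i <;> fin_cases j <;> simp [pauliX, pauliY, pauliZ, Matrix.mul_apply]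

lemma pauliY_mul_pauliZ : pauliY * pauliZ = Complex.I • pauliX := by
  ext i j; fin_cases i <;> fin_cases j <;> simp [pauliX, pauliY, pauliZ, Matrix.mul_apply]

lemma pauliZ_mul_pauliY : pauliZ * pauliY = -(Complex.I • pauliX) := by
  ext i j; fin_cases i <;> fin_cases j <;> simp [pauliX, pauliY, pauliZ, Matrix.mul_apply]

lemma pauliZ_mul_pauliX : pauliZ * pauliX = -(pauliX * pauliZ) := by
  ext i j; fin_cases i <;> fin_cases j <;> simp [pauliX, pauliZ, Matrix.mul_apply]

@[simp] lemma pauliX_conjTranspose : pauliXᴴ = pauliX := by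
  ext i j; fin_cases i <;> fin_cases j <;> simp [pauliX]

@[simp] lemma pauliY_conjTranspose : pauliYᴴ = pauliY := by
  ext i j; fin_cases i <;> fin_cases j <;> simp [pauliY]

@[simp] lemma pauliZ_conjTranspose : pauliZᴴ = pauliZ := by
  ext i j; fin_cases i <;> fin_cases j <;> simp [pauliZ]

end Pauli

section TensorOp

variable {n : ℕ}

lemma tensorOp_mul (A B : Fin n → Matrix (Fin 2) (Fin 2) ℂ) :
    tensorOp A * tensorOp B = tensorOp fun k => A k * B k := by
  ext x y
  simp only [tensorOp, Matrix.mul_apply, Matrix.of_apply, ← Finset.prod_mul_distrib]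
  exact (Fintype.prod_sum fun k j => A k (x k) j * B k j (y k)).symm

lemma tensorOp_one : tensorOp (fun _ : Fin n => (1 : Matrix (Fin 2) (Fin 2) ℂ)) = 1 := by
  ext x y
  simp only [tensorOp, Matrix.of_apply, Matrix.one_apply, Finset.prod_ite_zero, Finset.prod_const_one]
  simp [funext_iff]

lemma tensorOp_smul (a : Fin n → ℂ) (A : Fin n → Matrix (Fin 2) (Fin 2) ℂ) :
    tensorOp (fun k => a k • A k) = (∏ k, a k) • tensorOp A := by
  ext x y
  simp [tensorOp, Finset.prod_mul_distrib]

lemma tensorOp_conjTranspose (A : Fin n → Matrix (Fin 2) (Fin 2) ℂ) :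
    (tensorOp A)ᴴ = tensorOp fun k => (A k)ᴴ := by
  ext x y
  simp [tensorOp]

end TensorOp

/-! ### Clifford relations, orthogonality and purity -/

section Majorana

variable {n : ℕ}

@[simp] lemma majorana_mul_self (μ : Fin (2 * n)) : majorana n μ * majorana n μ = 1 := by
  rw [majorana, tensorOp_mul, ← tensorOp_one]
  congr 1; ext1 k
  split_ifs <;> simp

@[simp] lemma majorana_conjTranspose (μ : Fin (2 * n)) : (majorana n μ)ᴴ = majorana n μ := by
  rw [majorana, tensorOp_conjTranspose]
  congr 1; ext1 k
  split_ifs <;> simp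

/-- Only at site $\mu/2$ do two different Pauli matrices meet: $X$ or $Y$ against the $Z$ string of
$c_\nu$, or $X$ against $Y$ when both indices share the site. The factors commute everywhere else.
-/
lemma majorana_anticomm_of_lt {μ ν : Fin (2 * n)} (h : μ < ν) :
    majorana n μ * majorana n ν = -(majorana n ν * majorana n μ) := by
  have hμ : (μ : ℕ) / 2 < n := by have := μ.2; omega
  have hlt : (μ : ℕ) < ν := h
  have hle : (μ : ℕ) / 2 ≤ ν / 2 := by omega
  rw [majorana, majorana, tensorOp_mul, tensorOp_mul]
  have key := tensorOp_smul (fun k : Fin n => if k = ⟨(μ : ℕ) / 2, hμ⟩ then (-1 : ℂ) else 1)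
    (fun k => (if (k : ℕ) < (ν : ℕ) / 2 then pauliZ
      else if (k : ℕ) = (ν : ℕ) / 2 then (if (ν : ℕ) % 2 = 0 then pauliX else pauliY)
      else 1) * (if (k : ℕ) < (μ : ℕ) / 2 then pauliZ
      else if (k : ℕ) = (μ : ℕ) / 2 then (if (μ : ℕ) % 2 = 0 then pauliX else pauliY)
      else 1))
  rw [Finset.prod_ite_eq' Finset.univ, if_pos (Finset.mem_univ _), neg_one_smul] at key
  rw [← key]
  congr 1; ext1 k
  simp only [Fin.ext_iff]
  rcases lt_trichotomy (k : ℕ) ((μ : ℕ) / 2) with hk | hk | hk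
  · simp [hk, hk.trans_le hle, hk.ne]
  · rcases hle.lt_or_eq with h2 | h2
    · rcases Nat.mod_two_eq_zero_or_one μ with hm | hm <;>
        simp [hk, h2, hm, pauliZ_mul_pauliX, pauliZ_mul_pauliY, pauliY_mul_pauliZ]
    · have h0 : (μ : ℕ) % 2 = 0 := by omega
      have h1 : (ν : ℕ) % 2 = 1 := by omega
      simp [hk, ← h2, h0, h1, pauliX_mul_pauliY, pauliY_mul_pauliX]
  · simp [hk.not_gt, hk.ne']

lemma majorana_anticomm {μ ν : Fin (2 * n)} (h : μ ≠ ν) :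
    majorana n μ * majorana n ν = -(majorana n ν * majorana n μ) := by
  rcases lt_or_gt_of_ne h with h | h
  · exact majorana_anticomm_of_lt h
  · rw [majorana_anticomm_of_lt h, neg_neg]

/-- Moving an operator past a product of Majorana operators, each of which it commutes with
up to a scalar. -/
lemma mul_majoranaProd {W : Op n} {η : Fin (2 * n) → ℂ}
    (h : ∀ ν, W * majorana n ν = η ν • (majorana n ν * W)) (s : Finset (Fin (2 * n))) :
    W * majoranaProd n s = (∏ ν ∈ s, η ν) • (majoranaProd n s * W) := by
  have key : ∀ l : List (Fin (2 * n)),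
      W * (l.map (majorana n)).prod = (l.map η).prod • ((l.map (majorana n)).prod * W) := by
    intro l
    induction l with
    | nil => simp
    | cons a l ih =>
      simp only [List.map_cons, List.prod_cons]
      rw [← mul_assoc, h, Matrix.smul_mul, mul_assoc, ih, Matrix.mul_smul, smul_smul, mul_assoc]
  have hp : ∏ ν ∈ s, η ν = (s.sort.map η).prod := by
    rw [← List.prod_toFinset _ (s.sort_nodup _), Finset.sort_toFinset]
  rw [hp]
  exact key _

lemma majoranaProd_mul_conjTranspose (s : Finset (Fin (2 * n))) :
    majoranaProd n s * (majoranaProd n s)ᴴ = 1 := by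
  have key : ∀ l : List (Fin (2 * n)),
      (l.map (majorana n)).prod * ((l.map (majorana n)).prod)ᴴ = 1 := by
    intro l
    induction l with
    | nil => simp
    | cons a l ih =>
      simp only [List.map_cons, List.prod_cons, Matrix.conjTranspose_mul, majorana_conjTranspose]
      rw [mul_assoc, ← mul_assoc _ _ (majorana n a), ih, one_mul, majorana_mul_self]
  exact key _

lemma majoranaProd_conjTranspose_mul (s : Finset (Fin (2 * n))) :
    (majoranaProd n s)ᴴ * majoranaProd n s = 1 :=
  mul_eq_one_comm.mp (majoranaProd_mul_conjTranspose s)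

/-- Equality up to sign. -/
def SignEq (A B : Op n) : Prop := A = B ∨ A = -B

lemma SignEq.refl (A : Op n) : SignEq A A := Or.inl rfl

lemma SignEq.symm {A B : Op n} (h : SignEq A B) : SignEq B A := by
  rcases h with h | h
  · exact Or.inl h.symm
  · exact Or.inr (by rw [h, neg_neg])

lemma SignEq.trans {A B C : Op n} (h : SignEq A B) (h' : SignEq B C) : SignEq A C := by
  rcases h with rfl | rfl
  · exact h'
  · rcases h' with rfl | rfl
    · exact Or.inr rfl
    · exact Or.inl (neg_neg _)

lemma SignEq.mul_left {A B : Op n} (C : Op n) (h : SignEq A B) : SignEq (C * A) (C * B) := by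
  rcases h with rfl | rfl
  · exact SignEq.refl _
  · exact Or.inr (mul_neg _ _)

lemma SignEq.mem {A B : Op n} {S : Submodule ℂ (Op n)} (h : SignEq A B) (hB : B ∈ S) :
    A ∈ S := by
  rcases h with rfl | rfl
  · exact hB
  · exact S.neg_mem hB

lemma signEq_prod_of_perm {l l' : List (Fin (2 * n))} (h : l.Perm l') :
    SignEq (l.map (majorana n)).prod (l'.map (majorana n)).prod := by
  induction h with
  | nil => exact SignEq.refl _
  | cons a _ ih => simpa using ih.mul_left (majorana n a)
  | swap a b l =>
    simp only [List.map_cons, List.prod_cons, ← mul_assoc]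
    by_cases hab : a = b
    · subst hab; exact SignEq.refl _
    · exact Or.inr (by rw [majorana_anticomm (Ne.symm hab), neg_mul])
  | trans _ _ ih ih' => exact ih.trans ih'

lemma signEq_majoranaProd_insert {s : Finset (Fin (2 * n))} {ν : Fin (2 * n)} (h : ν ∉ s) :
    SignEq (majoranaProd n (insert ν s)) (majorana n ν * majoranaProd n s) := by
  have hp : (insert ν s).sort.Perm (ν :: s.sort) := by
    rw [← Multiset.coe_eq_coe, Finset.sort_eq, ← Multiset.cons_coe, Finset.sort_eq,
      Finset.insert_val_of_notMem h]
  simpa [majoranaProd] using signEq_prod_of_perm hp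

lemma signEq_majoranaProd_erase {s : Finset (Fin (2 * n))} {ν : Fin (2 * n)} (h : ν ∈ s) :
    SignEq (majoranaProd n (s.erase ν)) (majorana n ν * majoranaProd n s) := by
  have h1 := (signEq_majoranaProd_insert (Finset.notMem_erase ν s)).mul_left (majorana n ν)
  rw [Finset.insert_erase h, ← mul_assoc, majorana_mul_self, one_mul] at h1
  exact h1.symm

/-- Each factor contributes $-1$, except $c_\nu$ itself, which commutes with $c_\nu$. -/
lemma majorana_mul_majoranaProd (ν : Fin (2 * n)) (s : Finset (Fin (2 * n))) :
    majorana n ν * majoranaProd n s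
      = ((-1) ^ s.card * if ν ∈ s then -1 else 1 : ℂ) • (majoranaProd n s * majorana n ν) := by
  have h : ∀ i, majorana n ν * majorana n i
      = ((-1) * if i = ν then -1 else 1 : ℂ) • (majorana n i * majorana n ν) := by
    intro i
    split_ifs with hi
    · subst hi; simp
    · rw [majorana_anticomm (Ne.symm hi)]; simp
  rw [mul_majoranaProd h, Finset.prod_mul_distrib, Finset.prod_const, Finset.prod_ite_eq']

lemma trace_eq_zero_of_conj_neg {W A : Op n} (hW : W * W = 1) (h : W * A = -(A * W)) :
    A.trace = 0 := by
  have h1 : (W * A * W).trace = A.trace := by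
    rw [Matrix.trace_mul_comm, ← mul_assoc, hW, one_mul]
  rw [h, neg_mul, mul_assoc, hW, mul_one, Matrix.trace_neg] at h1
  exact self_eq_neg.mp h1.symm

/-- Distinct Majorana products of the same degree are orthogonal. -/
lemma trace_conjTranspose_mul_majoranaProd {s t : Finset (Fin (2 * n))} (hst : s.card = t.card) :
    ((majoranaProd n s)ᴴ * majoranaProd n t).trace = if s = t then (2 : ℂ) ^ n else 0 := by
  split_ifs with h
  · subst h
    simp [majoranaProd_conjTranspose_mul, Matrix.trace_one]
  -- As $|s|=|t|$, moving $c_\nu$ past $c^s$ and past $c^t$ gives opposite signs. So $c_\nu$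
  -- anticommutes with $(c^s)^\dagger c^t$, whose trace must vanish.
  · obtain ⟨ν, hνs, hνt⟩ : ∃ ν ∈ s, ν ∉ t := by
      by_contra! hcon
      exact h (Finset.eq_of_subset_of_card_le hcon hst.ge)
    refine trace_eq_zero_of_conj_neg (majorana_mul_self ν) ?_
    have hs := majorana_mul_majoranaProd ν s
    have ht := majorana_mul_majoranaProd ν t
    rw [if_pos hνs] at hs
    rw [if_neg hνt, ← hst] at ht
    have hs' := congrArg Matrix.conjTranspose hs
    simp only [Matrix.conjTranspose_mul, majorana_conjTranspose, Matrix.conjTranspose_smul] at hs'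
    rcases neg_one_pow_eq_or ℂ s.card with e | e
    · simp only [e] at hs' ht
      simp only [mul_neg, mul_one, star_neg, star_one, neg_smul, one_smul] at hs' ht
      rw [← mul_assoc, ← neg_eq_iff_eq_neg.mpr hs', neg_mul, mul_assoc, ht, mul_assoc]
    · simp only [e] at hs' ht
      simp only [mul_neg, mul_one, neg_neg, star_one, neg_smul, one_smul] at hs' ht
      rw [← mul_assoc, ← hs', mul_assoc, ht, mul_neg, mul_assoc]

lemma majoranaProd_mem_module {κ : ℕ} {s : Finset (Fin (2 * n))} (h : s.card = κ) :
    majoranaProd n s ∈ majoranaModule n κ :=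
  Submodule.subset_span ⟨s, h, rfl⟩

lemma majoranaModule_eq_span_range (n κ : ℕ) :
    majoranaModule n κ = Submodule.span ℂ (Set.range fun s : Finset.powersetCard κ
      (Finset.univ : Finset (Fin (2 * n))) => majoranaProd n s) := by
  unfold majoranaModule
  congr 1
  ext A
  simp [eq_comm]

lemma sum_trace_smul_majoranaProd {κ : ℕ} (a : Finset (Fin (2 * n)) → ℂ)
    {t : Finset (Fin (2 * n))} (ht : t.card = κ) :
    ((majoranaProd n t)ᴴ * ∑ s ∈ Finset.powersetCard κ Finset.univ,
      a s • majoranaProd n s).trace = 2 ^ n * a t := by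
  rw [Finset.mul_sum, Matrix.trace_sum, Finset.sum_eq_single t]
  · rw [Matrix.mul_smul, Matrix.trace_smul, trace_conjTranspose_mul_majoranaProd rfl, if_pos rfl,
      smul_eq_mul, mul_comm]
  · intro s hs hst
    rw [Matrix.mul_smul, Matrix.trace_smul, trace_conjTranspose_mul_majoranaProd
      (ht.trans (Finset.mem_powersetCard_univ.mp hs).symm), if_neg hst.symm, smul_zero]
  · simp [ht]

lemma linearIndependent_majoranaProd (n κ : ℕ) :
    LinearIndependent ℂ fun s : Finset.powersetCard κ (Finset.univ : Finset (Fin (2 * n))) =>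
      majoranaProd n s := by
  rw [Fintype.linearIndependent_iff]
  intro a ha t
  have h := sum_trace_smul_majoranaProd (n := n)
    (fun s => if h : s ∈ Finset.powersetCard κ Finset.univ then a ⟨s, h⟩ else 0)
    (Finset.mem_powersetCard_univ.mp t.2)
  rw [← Finset.sum_attach] at h
  simp only [Finset.coe_mem, dif_pos, Subtype.coe_eta] at h
  rw [Finset.univ_eq_attach] at ha
  rw [ha] at h
  simpa using h.symm

lemma finrank_majoranaModule (n κ : ℕ) :
    Module.finrank ℂ (majoranaModule n κ) = (2 * n).choose κ := by
  rw [majoranaModule_eq_span_range, finrank_span_eq_card (linearIndependent_majoranaProd n κ)]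
  simp

lemma component_mem_module (κ : ℕ) (M : Op n) : component κ M ∈ majoranaModule n κ :=
  Submodule.sum_mem _ fun _ hs => Submodule.smul_mem _ _
    (majoranaProd_mem_module (Finset.mem_powersetCard_univ.mp hs))

/-- `M - M_κ` is orthogonal to `𝓑_κ`. -/
lemma trace_conjTranspose_mul_component {κ : ℕ} {B : Op n} (hB : B ∈ majoranaModule n κ)
    (M : Op n) : (Bᴴ * component κ M).trace = (Bᴴ * M).trace := by
  induction hB using Submodule.span_induction with
  | mem B hB =>
    obtain ⟨s, hs, rfl⟩ := hB
    rw [component, sum_trace_smul_majoranaProd _ hs, mul_inv_cancel_left₀ (by simp)]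
  | zero => simp
  | add B C _ _ hB hC =>
    simp only [Matrix.conjTranspose_add, add_mul, Matrix.trace_add, hB, hC]
  | smul a B _ hB =>
    simp only [Matrix.conjTranspose_smul, Matrix.smul_mul, Matrix.trace_smul, hB]

/-- The difference $M_\kappa-N$ lies in $\mathcal B_\kappa$ and is orthogonal to $\mathcal
B_\kappa$, hence to itself. -/
lemma component_eq_of_orthogonal {κ : ℕ} {M N : Op n} (hN : N ∈ majoranaModule n κ)
    (h : ∀ B ∈ majoranaModule n κ, (Bᴴ * N).trace = (Bᴴ * M).trace) : component κ M = N := by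
  have hmem := Submodule.sub_mem _ (component_mem_module κ M) hN
  have h0 : ((component κ M - N)ᴴ * (component κ M - N)).trace = 0 := by
    rw [mul_sub, Matrix.trace_sub, trace_conjTranspose_mul_component hmem, h _ hmem, sub_self]
  exact sub_eq_zero.mp (Matrix.trace_conjTranspose_mul_self_eq_zero_iff.mp h0)

lemma component_eq_self {κ : ℕ} {B : Op n} (hB : B ∈ majoranaModule n κ) : component κ B = B :=
  component_eq_of_orthogonal hB fun _ _ => rfl

/-- Parseval's identity for the `κ`-purity. -/
lemma purity_eq_sum (κ : ℕ) (M : Op n) :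
    2 ^ n * purity κ M = ∑ s ∈ Finset.powersetCard κ Finset.univ,
      ‖((majoranaProd n s)ᴴ * M).trace‖ ^ 2 := by
  have h : ((2 : ℂ) ^ n) * ((component κ M)ᴴ * component κ M).trace
      = ((∑ s ∈ Finset.powersetCard κ Finset.univ,
        ‖((majoranaProd n s)ᴴ * M).trace‖ ^ 2 : ℝ) : ℂ) := by
    rw [trace_conjTranspose_mul_component (component_mem_module κ M)]
    simp only [component, Matrix.conjTranspose_sum, Finset.sum_mul, Matrix.trace_sum,
      Matrix.conjTranspose_smul, Matrix.smul_mul, Matrix.trace_smul, Finset.mul_sum]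
    push_cast
    refine Finset.sum_congr rfl fun s _ => ?_
    rw [← Complex.conj_mul']
    simp only [star_mul', star_inv₀, star_pow, smul_eq_mul, Complex.star_def, map_ofNat]
    rw [← mul_assoc, ← mul_assoc, mul_inv_cancel₀ (by simp), one_mul]
  have h' := congrArg Complex.re h
  rw [Complex.ofReal_re] at h'
  rw [← h', purity, show (2 : ℂ) ^ n = ((2 ^ n : ℝ) : ℂ) by push_cast; rfl, Complex.re_ofReal_mul]

end Majorana

attribute [local instance 100] LieRing.ofAssociativeRing

/-! ### Majorana bilinears and the circuit generators -/

section Bilinear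

variable {n : ℕ}

/-- `c_μ c_ν`. -/
def majoranaPair (n : ℕ) (μ ν : Fin (2 * n)) : Op n := majorana n μ * majorana n ν

lemma majoranaPair_mul_self {μ ν : Fin (2 * n)} (h : μ ≠ ν) :
    majoranaPair n μ ν * majoranaPair n μ ν = -1 := by
  rw [majoranaPair, mul_assoc, ← mul_assoc (majorana n ν), majorana_anticomm h.symm, neg_mul,
    mul_assoc, majorana_mul_self, mul_one, mul_neg, majorana_mul_self]

lemma majoranaPair_conjTranspose {μ ν : Fin (2 * n)} (h : μ ≠ ν) :
    (majoranaPair n μ ν)ᴴ = -majoranaPair n μ ν := by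
  rw [majoranaPair, Matrix.conjTranspose_mul, majorana_conjTranspose, majorana_conjTranspose,
    majorana_anticomm h.symm]

/-- The two signs $(-1)^{|s|}$ cancel, so only membership of $\mu$ and $\nu$ matters. -/
lemma majoranaPair_mul_majoranaProd (μ ν : Fin (2 * n)) (s : Finset (Fin (2 * n))) :
    majoranaPair n μ ν * majoranaProd n s
      = ((if μ ∈ s then -1 else 1) * (if ν ∈ s then -1 else 1) : ℂ) •
        (majoranaProd n s * majoranaPair n μ ν) := by
  rw [majoranaPair, mul_assoc, majorana_mul_majoranaProd, Matrix.mul_smul, ← mul_assoc,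
    majorana_mul_majoranaProd, Matrix.smul_mul, smul_smul, mul_assoc (majoranaProd n s)]
  congr 1
  have h : ((-1 : ℂ) ^ s.card) * (-1) ^ s.card = 1 := by rw [← mul_pow]; simp
  linear_combination ((if μ ∈ s then -1 else 1) * (if ν ∈ s then -1 else 1) : ℂ) * h

lemma majoranaPair_mul_of_mem_iff {μ ν : Fin (2 * n)} {s : Finset (Fin (2 * n))}
    (h : μ ∈ s ↔ ν ∈ s) :
    majoranaPair n μ ν * majoranaProd n s = majoranaProd n s * majoranaPair n μ ν := by
  rw [majoranaPair_mul_majoranaProd]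
  by_cases hν : ν ∈ s <;> simp [h, hν]

lemma majoranaPair_mul_of_not_mem_iff {μ ν : Fin (2 * n)} {s : Finset (Fin (2 * n))}
    (h : ¬(μ ∈ s ↔ ν ∈ s)) :
    majoranaPair n μ ν * majoranaProd n s = -(majoranaProd n s * majoranaPair n μ ν) := by
  rw [majoranaPair_mul_majoranaProd]
  by_cases hν : ν ∈ s <;> by_cases hμ : μ ∈ s <;> simp_all

lemma map_swap_of_mem_iff {μ ν : Fin (2 * n)} {s : Finset (Fin (2 * n))} (h : μ ∈ s ↔ ν ∈ s) :
    s.map (Equiv.swap μ ν).toEmbedding = s := by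
  ext x
  rw [Finset.mem_map_equiv, Equiv.symm_swap]
  rcases eq_or_ne x μ with rfl | h1
  · simp [h]
  · rcases eq_or_ne x ν with rfl | h2
    · simp [h]
    · rw [Equiv.swap_apply_of_ne_of_ne h1 h2]

/-- When $\mu\in s$ and $\nu\notin s$, left multiplication by $c_\mu c_\nu$ inserts $\nu$ and
cancels $\mu$; restoring the order costs a sign. -/
lemma signEq_majoranaProd_map_swap {μ ν : Fin (2 * n)} {s : Finset (Fin (2 * n))}
    (h : ¬(μ ∈ s ↔ ν ∈ s)) :
    SignEq (majoranaProd n (s.map (Equiv.swap μ ν).toEmbedding))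
      (majoranaPair n μ ν * majoranaProd n s) := by
  wlog hμ : μ ∈ s generalizing μ ν
  · have hne : μ ≠ ν := fun e => h (by rw [e])
    have := this (μ := ν) (ν := μ) (fun e => h e.symm) (by tauto)
    rw [Equiv.swap_comm]
    refine this.trans (Or.inr ?_)
    rw [majoranaPair, majoranaPair, majorana_anticomm hne.symm, neg_mul]
  have hν : ν ∉ s := by tauto
  have hne : μ ≠ ν := fun e => hν (e ▸ hμ)
  have hs : s.map (Equiv.swap μ ν).toEmbedding = (insert ν s).erase μ := by
    ext x
    rw [Finset.mem_map_equiv, Equiv.symm_swap]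
    rcases eq_or_ne x μ with rfl | h1
    · simp [hν]
    · rcases eq_or_ne x ν with rfl | h2
      · simp [hμ, h1]
      · rw [Equiv.swap_apply_of_ne_of_ne h1 h2]
        simp [h1, h2]
  rw [hs, majoranaPair, mul_assoc]
  exact (signEq_majoranaProd_erase (Finset.mem_insert_of_mem hμ)).trans
    ((signEq_majoranaProd_insert hν).mul_left _)

lemma smul_tensorOp (a : ℂ) (P : Fin n → Matrix (Fin 2) (Fin 2) ℂ) (i : Fin n) :
    a • tensorOp P = tensorOp fun k => (if k = i then a else 1) • P k := by
  rw [tensorOp_smul, Finset.prod_ite_eq' Finset.univ, if_pos (Finset.mem_univ _)]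

lemma I_smul_zAt (i : Fin n) : Complex.I • zAt i
    = majoranaPair n ⟨2 * i, by omega⟩ ⟨2 * i + 1, by omega⟩ := by
  rw [majoranaPair, majorana, majorana, tensorOp_mul, zAt, smul_tensorOp _ _ i]
  congr 1; ext1 k
  have e1 : 2 * (i : ℕ) / 2 = i := by omega
  have e2 : (2 * (i : ℕ) + 1) / 2 = i := by omega
  have e3 : (2 * (i : ℕ) + 1) % 2 = 1 := by omega
  simp only [e1, e2, e3, Fin.ext_iff]
  rcases lt_trichotomy (k : ℕ) i with hk | hk | hk
  · simp [hk, hk.ne]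
  · simp [hk, pauliX_mul_pauliY]
  · simp [hk.not_gt, hk.ne']

/-- The $Z$ strings cancel before site $i$; the longer one leaves $YZ=iX$ at $i$, next to the $X$ at
$j$. -/
lemma I_smul_xxAt {i j : Fin n} (hij : (i : ℕ) + 1 = j) : Complex.I • xxAt i j
    = majoranaPair n ⟨2 * i + 1, by omega⟩ ⟨2 * j, by omega⟩ := by
  rw [majoranaPair, majorana, majorana, tensorOp_mul, xxAt, smul_tensorOp _ _ i]
  congr 1; ext1 k
  have e1 : 2 * (j : ℕ) / 2 = j := by omega
  have e2 : (2 * (i : ℕ) + 1) / 2 = i := by omega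
  have e3 : (2 * (i : ℕ) + 1) % 2 = 1 := by omega
  simp only [e1, e2, e3, Fin.ext_iff]
  rcases lt_trichotomy (k : ℕ) i with hk | hk | hk
  · have h1 : (k : ℕ) < j := by omega
    simp [hk, hk.ne, h1, h1.ne]
  · have h1 : (i : ℕ) < j := by omega
    simp [hk, h1, pauliY_mul_pauliZ]
  · rcases (show (j : ℕ) ≤ k by omega).eq_or_lt with h2 | h2
    · have h1 : ¬ ((j : ℕ) < i) := by omega
      have h3 : (j : ℕ) ≠ i := by omega
      simp [← h2, h1, h3]
    · simp [hk.not_gt, hk.ne', h2.not_gt, h2.ne']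

/-- The generators of the circuit are, up to the factor `i`, products of adjacent Majorana
operators. -/
lemma exists_majoranaPair_of_generator {H : Op n} (hH : H ∈ generators n) :
    ∃ μ ν : Fin (2 * n), (μ : ℕ) + 1 = ν ∧ Complex.I • H = majoranaPair n μ ν := by
  rcases hH with ⟨i, rfl⟩ | ⟨i, j, hij, rfl⟩
  · exact ⟨_, _, rfl, I_smul_zAt i⟩
  · exact ⟨_, _, by simp; omega, I_smul_xxAt hij⟩

lemma exists_generator_of_majoranaPair {μ ν : Fin (2 * n)} (h : (μ : ℕ) + 1 = ν) :
    ∃ H ∈ generators n, majoranaPair n μ ν = Complex.I • H := by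
  have hν := ν.2
  rcases Nat.even_or_odd' (μ : ℕ) with ⟨i, hi | hi⟩
  · refine ⟨_, Or.inl ⟨⟨i, by omega⟩, rfl⟩, ?_⟩
    rw [I_smul_zAt]
    congr 1 <;> ext <;> simp <;> omega
  · refine ⟨_, Or.inr ⟨⟨i, by omega⟩, ⟨i + 1, by omega⟩, rfl, rfl⟩, ?_⟩
    rw [I_smul_xxAt rfl]
    congr 1 <;> ext <;> simp <;> omega

lemma majoranaPair_mem_dla {μ ν : Fin (2 * n)} (h : (μ : ℕ) + 1 = ν) :
    majoranaPair n μ ν ∈ dla n := by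
  obtain ⟨H, hH, e⟩ := exists_generator_of_majoranaPair h
  exact LieSubalgebra.subset_lieSpan ⟨H, hH, e⟩

end Bilinear

/-! ### Rotations generated by adjacent pairs -/

section Exponential

variable {n : ℕ}

open scoped Matrix.Norms.Operator in
/-- The exponential of `x g` where `g² = -1`. -/
lemma exp_smul_of_mul_self_eq_neg_one {n : ℕ} {g : Op n} (hg : g * g = -1) (x : ℝ) :
    NormedSpace.exp ((x : ℂ) • g) = (Real.cos x : ℂ) • 1 + (Real.sin x : ℂ) • g := by
  have h := NormedSpace.map_exp (Complex.liftAux g hg)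
    (LinearMap.continuous_of_finiteDimensional (Complex.liftAux g hg).toLinearMap)
    ((x : ℂ) * Complex.I)
  have e : Complex.liftAux g hg ((x : ℂ) * Complex.I) = (x : ℂ) • g := by simp
  rw [← Complex.exp_eq_exp_ℂ, e, Complex.liftAux_apply, Complex.exp_ofReal_mul_I_re,
    Complex.exp_ofReal_mul_I_im, Algebra.algebraMap_eq_smul_one] at h
  exact h.symm

lemma exp_smul_mem_unitaryGroup {g : Op n} (hg : g * g = -1) (hg' : gᴴ = -g) (x : ℝ) :
    NormedSpace.exp ((x : ℂ) • g) ∈ Matrix.unitaryGroup (Basis n) ℂ := by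
  rw [Matrix.mem_unitaryGroup_iff, exp_smul_of_mul_self_eq_neg_one hg, Matrix.star_eq_conjTranspose]
  simp only [Matrix.conjTranspose_add, Matrix.conjTranspose_smul, Matrix.conjTranspose_one, hg',
    add_mul, mul_add, Matrix.smul_mul, Matrix.mul_smul, one_mul, mul_one, mul_neg, hg, smul_neg,
    smul_smul, Complex.star_def, Complex.conj_ofReal]
  have : (Real.cos x : ℂ) * Real.cos x + Real.sin x * Real.sin x = 1 := by
    have := Complex.cos_sq_add_sin_sq x
    push_cast; linear_combination this
  calc _ = ((Real.cos x : ℂ) * Real.cos x + Real.sin x * Real.sin x) • (1 : Op n) := by module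
    _ = 1 := by rw [this, one_smul]

/-- The quarter rotation `(1 + c_μ c_ν) / √2`. -/
lemma exists_mem_matchgateGroup_rotation {μ ν : Fin (2 * n)} (h : (μ : ℕ) + 1 = ν) :
    ∃ R : matchgateGroup n, (R : Op n) * (R : Op n) = majoranaPair n μ ν ∧
      ∃ a : ℝ, (R : Op n) = (a : ℂ) • (1 + majoranaPair n μ ν) := by
  have hne : μ ≠ ν := by rintro rfl; omega
  have hg := majoranaPair_mul_self hne
  let R : matchgateGroup n :=
    ⟨⟨_, exp_smul_mem_unitaryGroup hg (majoranaPair_conjTranspose hne) (Real.pi / 4)⟩,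
      Subgroup.le_topologicalClosure _ (Subgroup.subset_closure
        ⟨_, (dla n).smul_mem (Real.pi / 4) (majoranaPair_mem_dla h), rfl⟩)⟩
  have hR : (R : Op n) = ((√2 / 2 : ℝ) : ℂ) • (1 + majoranaPair n μ ν) := by
    rw [smul_add]
    nth_rw 1 [← Real.cos_pi_div_four]
    rw [← Real.sin_pi_div_four]
    exact exp_smul_of_mul_self_eq_neg_one hg _
  refine ⟨R, ?_, _, hR⟩
  -- With $g=c_\mu c_\nu$ and $g^2=-1$ one has $(1+g)^2=2g$, so $R^2=2a^2g$ for $a=\sqrt2/2$.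
  have ha : 2 * (((√2 / 2 : ℝ) : ℂ) * ((√2 / 2 : ℝ) : ℂ)) = 1 := by
    have := Real.mul_self_sqrt (show (0 : ℝ) ≤ 2 by norm_num)
    have h2 : 2 * ((√2 / 2) * (√2 / 2)) = 1 := by linear_combination this / 2
    exact_mod_cast h2
  rw [hR, Matrix.smul_mul, Matrix.mul_smul, smul_smul, mul_add, add_mul, add_mul, hg, one_mul,
    mul_one, one_mul]
  calc _ = (2 * (((√2 / 2 : ℝ) : ℂ) * ((√2 / 2 : ℝ) : ℂ))) • majoranaPair n μ ν := by module
    _ = _ := by rw [ha, one_smul]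

end Exponential

/-! ### Invariance of $\mathcal B_\kappa$ and of the purity under $G$ -/

section Adjoint

variable {n : ℕ}

/-- Conjugation by `exp a` preserves every closed subspace that is stable under the commutator
with `a`. -/
lemma exp_mul_mul_exp_neg_mem_of_commutator_mem {𝔸 : Type*} [NormedRing 𝔸] [NormedAlgebra ℂ 𝔸]
    [CompleteSpace 𝔸] {S : Submodule ℂ 𝔸} (hS : IsClosed (S : Set 𝔸)) {a : 𝔸}
    (ha : ∀ b ∈ S, a * b - b * a ∈ S) {b : 𝔸} (hb : b ∈ S) :
    NormedSpace.exp a * b * NormedSpace.exp (-a) ∈ S := by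
  let : NormedAlgebra ℚ 𝔸 := .restrictScalars ℚ ℂ 𝔸
  let : NormedAlgebra ℚ (𝔸 →L[ℂ] 𝔸) := .restrictScalars ℚ ℂ (𝔸 →L[ℂ] 𝔸)
  -- Left and right multiplications commute, so $e^a b
  -- e^{-a}=\exp(L_a+R_{-a})\,b=\exp(\mathrm{ad}_a)\,b$. The partial sums of this series lie in the
  -- closed subspace $S$.
  set L := ContinuousLinearMap.mul ℂ 𝔸 with hL
  set R := (ContinuousLinearMap.mul ℂ 𝔸).flip with hR
  have expSum : ∀ (T : 𝔸 →L[ℂ] 𝔸) (x : 𝔸),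
      HasSum (fun k : ℕ => ((k.factorial : ℂ)⁻¹) • (T ^ k) x) (NormedSpace.exp T x) := fun T x =>
    (NormedSpace.exp_series_hasSum_exp' (𝕂 := ℂ) T).mapL (ContinuousLinearMap.apply ℂ 𝔸 x)
  have hLpow : ∀ (k : ℕ) (x y : 𝔸), (L x ^ k) y = x ^ k * y := by
    intro k x
    induction k with
    | zero => simp
    | succ k ih =>
      intro y
      rw [pow_succ, mul_apply_eq_comp, ih]
      simp [hL, pow_succ, mul_assoc]
  have hRpow : ∀ (k : ℕ) (x y : 𝔸), (R x ^ k) y = y * x ^ k := by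
    intro k x
    induction k with
    | zero => simp
    | succ k ih =>
      intro y
      rw [pow_succ, mul_apply_eq_comp, ih]
      simp [hR, pow_succ', mul_assoc]
  have hLexp : ∀ x y : 𝔸, NormedSpace.exp (L x) y = NormedSpace.exp x * y := by
    intro x y
    refine (expSum (L x) y).unique ?_
    simpa [hLpow] using (NormedSpace.exp_series_hasSum_exp' (𝕂 := ℂ) x).mul_right y
  have hRexp : ∀ x y : 𝔸, NormedSpace.exp (R x) y = y * NormedSpace.exp x := by
    intro x y
    refine (expSum (R x) y).unique ?_
    simpa [hRpow] using (NormedSpace.exp_series_hasSum_exp' (𝕂 := ℂ) x).mul_left y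
  have hcomm : Commute (L a) (R (-a)) := by
    ext x; simp [hL, hR, mul_assoc]
  have hexp : NormedSpace.exp (L a + R (-a)) b = NormedSpace.exp a * b * NormedSpace.exp (-a) := by
    rw [NormedSpace.exp_add_of_commute hcomm, mul_apply_eq_comp, hLexp, hRexp, mul_assoc]
  rw [← hexp]
  have hpow : ∀ k : ℕ, ((L a + R (-a)) ^ k) b ∈ S := by
    intro k
    induction k with
    | zero => simpa
    | succ k ih =>
      rw [pow_succ', mul_apply_eq_comp]
      simpa [hL, hR, sub_eq_add_neg] using ha _ ih
  exact hS.mem_of_tendsto (expSum _ b) (Filter.Eventually.of_forall fun s =>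
    S.sum_mem fun k _ => S.smul_mem _ (hpow k))

lemma exp_mul_mul_exp_neg_mem (S : Submodule ℂ (Op n)) {A : Op n}
    (hA : ∀ B ∈ S, A * B - B * A ∈ S) {B : Op n} (hB : B ∈ S) :
    NormedSpace.exp A * B * NormedSpace.exp (-A) ∈ S := by
  open scoped Matrix.Norms.Operator in
  exact exp_mul_mul_exp_neg_mem_of_commutator_mem S.closed_of_finiteDimensional hA hB

/-- On a product $c^s$ the commutator is zero or, up to sign, $2c^{s'}$ with $s'$ the image of $s$
under a transposition, so the degree is unchanged. -/
lemma majoranaPair_commutator_mem (κ : ℕ) {μ ν : Fin (2 * n)} {B : Op n}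
    (hB : B ∈ majoranaModule n κ) :
    majoranaPair n μ ν * B - B * majoranaPair n μ ν ∈ majoranaModule n κ := by
  induction hB using Submodule.span_induction with
  | mem B hB =>
    obtain ⟨s, hs, rfl⟩ := hB
    by_cases h : μ ∈ s ↔ ν ∈ s
    · rw [majoranaPair_mul_of_mem_iff h, sub_self]
      exact Submodule.zero_mem _
    · rw [← neg_eq_iff_eq_neg.mpr (majoranaPair_mul_of_not_mem_iff h), sub_neg_eq_add]
      have hm := (signEq_majoranaProd_map_swap h).symm.mem
        (majoranaProd_mem_module ((Finset.card_map _).trans hs))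
      exact Submodule.add_mem _ hm hm
  | zero => simp
  | add B C _ _ hB hC =>
    convert Submodule.add_mem _ hB hC using 1
    noncomm_ring
  | smul a B _ hB =>
    convert Submodule.smul_mem _ a hB using 1
    rw [Matrix.mul_smul, Matrix.smul_mul, smul_sub]

lemma dla_commutator_mem (κ : ℕ) {A : Op n} (hA : A ∈ dla n) :
    ∀ B ∈ majoranaModule n κ, A * B - B * A ∈ majoranaModule n κ := by
  induction hA using LieSubalgebra.lieSpan_induction with
  | mem A hA =>
    obtain ⟨H, hH, rfl⟩ := hA
    obtain ⟨μ, ν, -, e⟩ := exists_majoranaPair_of_generator hH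
    rw [e]
    exact fun B hB => majoranaPair_commutator_mem κ hB
  | zero => simp
  | add A A' _ _ h h' =>
    intro B hB
    convert Submodule.add_mem _ (h B hB) (h' B hB) using 1
    noncomm_ring
  | smul r A _ h =>
    intro B hB
    convert Submodule.smul_mem _ (r : ℂ) (h B hB) using 1
    rw [Complex.coe_smul, smul_sub, Matrix.smul_mul, Matrix.mul_smul]
  | lie A A' _ _ h h' =>
    intro B hB
    -- This is the Jacobi identity: $[[A,A'],B]=[A,[A',B]]-[A',[A,B]]$.
    convert Submodule.sub_mem _ (h _ (h' B hB)) (h' _ (h B hB)) using 1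
    rw [LieRing.of_associative_ring_bracket]
    noncomm_ring

/-- The subgroup of unitaries that preserve `S` by conjugation. -/
def conjStabilizer (S : Submodule ℂ (Op n)) : Subgroup (Matrix.unitaryGroup (Basis n) ℂ) where
  -- Asking for both conjugations makes closure under inverses immediate.
  carrier := {U | ∀ B ∈ S, (U : Op n) * B * (U : Op n)ᴴ ∈ S ∧ (U : Op n)ᴴ * B * (U : Op n) ∈ S}
  mul_mem' := by
    intro U V hU hV B hB
    simp only [Submonoid.coe_mul, Matrix.conjTranspose_mul]
    constructor
    · simpa only [mul_assoc] using (hU _ (hV B hB).1).1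
    · simpa only [mul_assoc] using (hV _ (hU B hB).2).2
  one_mem' := by simp
  inv_mem' := by
    intro U hU B hB
    simpa [← Matrix.star_eq_conjTranspose] using (hU B hB).symm

lemma isClosed_conjStabilizer (S : Submodule ℂ (Op n)) :
    IsClosed (conjStabilizer S : Set (Matrix.unitaryGroup (Basis n) ℂ)) := by
  have hS : IsClosed (S : Set (Op n)) := by
    open scoped Matrix.Norms.Operator in exact S.closed_of_finiteDimensional
  have : (conjStabilizer S : Set (Matrix.unitaryGroup (Basis n) ℂ)) = ⋂ B ∈ S,
      {U : Matrix.unitaryGroup (Basis n) ℂ | (U : Op n) * B * (U : Op n)ᴴ ∈ S} ∩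
        {U | (U : Op n)ᴴ * B * (U : Op n) ∈ S} := by
    ext U
    simp [conjStabilizer]
  rw [this]
  refine isClosed_biInter fun B _ => IsClosed.inter ?_ ?_
  · exact hS.preimage (by fun_prop)
  · exact hS.preimage (by fun_prop)

/-- Conjugation by elements of `G` preserves every `𝓑_κ`. -/
lemma matchgateGroup_le_conjStabilizer (n κ : ℕ) :
    matchgateGroup n ≤ conjStabilizer (majoranaModule n κ) := by
  refine Subgroup.topologicalClosure_minimal _ ?_ (isClosed_conjStabilizer _)
  rw [Subgroup.closure_le]
  rintro U ⟨A, hA, hU⟩ B hB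
  have hinv : (U : Op n)ᴴ = NormedSpace.exp (-A) := by
    rw [Matrix.exp_neg, ← hU]
    exact (Matrix.inv_eq_left_inv (Matrix.mem_unitaryGroup_iff'.mp U.2)).symm
  rw [hinv, hU]
  refine ⟨exp_mul_mul_exp_neg_mem _ (dla_commutator_mem κ hA) hB, ?_⟩
  have := exp_mul_mul_exp_neg_mem _ (dla_commutator_mem κ ((dla n).neg_mem hA)) hB
  rwa [neg_neg] at this

lemma conj_mem_majoranaModule {κ : ℕ} (g : matchgateGroup n) {B : Op n}
    (hB : B ∈ majoranaModule n κ) :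
    (g : Op n) * B * (g : Op n)ᴴ ∈ majoranaModule n κ :=
  (matchgateGroup_le_conjStabilizer n κ g.2 B hB).1

lemma conj_mem_majoranaModule' {κ : ℕ} (g : matchgateGroup n) {B : Op n}
    (hB : B ∈ majoranaModule n κ) :
    (g : Op n)ᴴ * B * (g : Op n) ∈ majoranaModule n κ :=
  (matchgateGroup_le_conjStabilizer n κ g.2 B hB).2

lemma matchgateGroup_conjTranspose_mul (g : matchgateGroup n) :
    (g : Op n)ᴴ * (g : Op n) = 1 :=
  Matrix.mem_unitaryGroup_iff'.mp g.1.2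

/-- Conjugation by $g$ is a Hilbert–Schmidt isometry that, with its inverse, preserves $\mathcal
B_\kappa$, so it commutes with the orthogonal projection. -/
lemma component_conj (κ : ℕ) (g : matchgateGroup n) (M : Op n) :
    component κ ((g : Op n) * M * (g : Op n)ᴴ)
      = (g : Op n) * component κ M * (g : Op n)ᴴ := by
  refine component_eq_of_orthogonal (conj_mem_majoranaModule g (component_mem_module κ M)) ?_
  intro B hB
  have key : ∀ N : Op n, (Bᴴ * ((g : Op n) * N * (g : Op n)ᴴ)).trace
      = (((g : Op n)ᴴ * B * (g : Op n))ᴴ * N).trace := by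
    intro N
    rw [← mul_assoc, Matrix.trace_mul_comm]
    simp only [Matrix.conjTranspose_mul, Matrix.conjTranspose_conjTranspose, mul_assoc]
  rw [key, key, trace_conjTranspose_mul_component (conj_mem_majoranaModule' g hB)]

/-- The `κ`-purity is invariant under conjugation by `G`. -/
lemma purity_conj (κ : ℕ) (g : matchgateGroup n) (M : Op n) :
    purity κ ((g : Op n) * M * (g : Op n)ᴴ) = purity κ M := by
  rw [purity, purity, component_conj]
  congr 1
  simp only [Matrix.conjTranspose_mul, Matrix.conjTranspose_conjTranspose]
  rw [mul_assoc, mul_assoc, mul_assoc, ← mul_assoc (g : Op n)ᴴ, matchgateGroup_conjTranspose_mul,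
    one_mul, Matrix.trace_mul_comm, mul_assoc, mul_assoc, matchgateGroup_conjTranspose_mul, mul_one]

end Adjoint

/-! ### Combinatorics of adjacent transpositions -/

section AdjacentSwaps

open scoped Pointwise

variable {N : ℕ}

/-- Adjacent transpositions generate the symmetric group, which is transitive on subsets of a given
size. -/
lemma eq_of_forall_adjacent_swap {β : Type*} {f : Finset (Fin N) → β}
    (hf : ∀ μ ν : Fin N, (μ : ℕ) + 1 = ν → ∀ s, f (s.map (Equiv.swap μ ν).toEmbedding) = f s)
    {s t : Finset (Fin N)} (hst : s.card = t.card) : f s = f t := by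
  have key : ∀ σ : Equiv.Perm (Fin N), ∀ s, f (s.map σ.toEmbedding) = f s := by
    cases N with
    | zero => exact fun σ s => congrArg f (Subsingleton.elim _ _)
    | succ m =>
      intro σ
      have hσ : σ ∈ Submonoid.closure
          (Set.range fun i : Fin m => Equiv.swap i.castSucc i.succ) := by
        rw [Equiv.Perm.mclosure_swap_castSucc_succ]; trivial
      induction hσ using Submonoid.closure_induction with
      | mem σ h =>
        obtain ⟨i, rfl⟩ := h
        exact hf _ _ (by simp)
      | one =>
        intro s
        congr 1
        exact Finset.map_refl
      | mul σ τ _ _ h h' =>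
        intro s
        rw [← h' s, ← h (s.map τ.toEmbedding), Finset.map_map]
        rfl
  have : MulAction.IsPretransitive (Equiv.Perm (Fin N)) (Set.powersetCard (Fin N) s.card) :=
    Set.powersetCard.isPretransitive
  obtain ⟨σ, hσ⟩ := MulAction.exists_smul_eq (Equiv.Perm (Fin N))
    (⟨s, rfl⟩ : Set.powersetCard (Fin N) s.card) ⟨t, hst.symm⟩
  have h := congrArg Subtype.val hσ
  rw [Set.powersetCard.coe_smul] at h
  rw [← key σ s]
  congr 1
  rw [← show σ • s = t from h]
  ext x
  simp only [Finset.mem_map, Finset.mem_smul_finset, Equiv.coe_toEmbedding, Equiv.Perm.smul_def]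

/-- Otherwise membership in $d$ would propagate from one index to the next and be constant. -/
lemma exists_adjacent_crossing {d : Finset (Fin N)} (h : d.Nonempty) (h' : d ≠ Finset.univ) :
    ∃ μ ν : Fin N, (μ : ℕ) + 1 = ν ∧ ¬(μ ∈ d ↔ ν ∈ d) := by
  by_contra! hcon
  obtain ⟨a, ha⟩ := h
  have hN : 0 < N := a.pos
  have key : ∀ k (hk : k < N), (⟨k, hk⟩ : Fin N) ∈ d ↔ (⟨0, hN⟩ : Fin N) ∈ d := by
    intro k
    induction k with
    | zero => exact fun _ => Iff.rfl
    | succ k ih =>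
      intro hk
      rw [← ih (by omega)]
      exact (hcon ⟨k, by omega⟩ ⟨k + 1, hk⟩ rfl).symm
  refine h' (Finset.eq_univ_iff_forall.mpr fun x => ?_)
  exact (key x x.2).mpr ((key a a.2).mp ha)

end AdjacentSwaps

/-! ### First and second Haar moments -/

section Haar

variable {n : ℕ}

instance : IsProbabilityMeasure (haarG n) := ⟨by
  have := Measure.haarMeasure_self (K₀ := (⊤ : TopologicalSpace.PositiveCompacts (matchgateGroup n)))
  simpa [haarG] using this⟩

instance : (haarG n).IsMulLeftInvariant := by unfold haarG; infer_instance

/-- Continuous functions of a continuously parametrized unitary are integrable. -/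
lemma integrable_comp_unitary {Θ : Type*} [TopologicalSpace Θ] [MeasurableSpace Θ]
    [OpensMeasurableSpace Θ] {m : Measure Θ} [IsFiniteMeasure m] {u : Θ → Op n}
    (hu : Continuous u) (hU : ∀ θ, u θ ∈ Matrix.unitaryGroup (Basis n) ℂ)
    {φ : Op n → ℂ} (hφ : Continuous φ) : Integrable (fun θ => φ (u θ)) m := by
  obtain ⟨C, hC⟩ := (isCompact_unitaryGroup n).exists_bound_of_continuousOn hφ.continuousOn
  exact Integrable.of_bound (hφ.comp hu).aestronglyMeasurable C
    (Filter.Eventually.of_forall fun θ => hC _ (hU θ))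

lemma continuous_matchgateGroup_coe : Continuous fun g : matchgateGroup n => (g : Op n) :=
  continuous_subtype_val.comp continuous_subtype_val

lemma integrable_haarG {φ : Op n → ℂ} (hφ : Continuous φ) :
    Integrable (fun g : matchgateGroup n => φ g) (haarG n) :=
  integrable_comp_unitary continuous_matchgateGroup_coe (fun g => g.1.2) hφ

/-- The expectation value `Tr[U ρ U† A]`. -/
def expect (ρ A U : Op n) : ℂ := (U * ρ * Uᴴ * A).trace

lemma continuous_expect (ρ A : Op n) : Continuous (expect ρ A) :=
  (((continuous_id.mul continuous_const).mul continuous_id.matrix_conjTranspose).mul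
    continuous_const).matrix_trace

/-- Heisenberg picture: this turns left invariance of Haar measure into invariance of the moments
under $A\mapsto h^\dagger A h$. -/
lemma expect_mul (ρ A U V : Op n) : expect ρ A (U * V) = expect ρ (Uᴴ * A * U) V := by
  unfold expect
  rw [Matrix.conjTranspose_mul, mul_assoc, mul_assoc, mul_assoc, Matrix.trace_mul_comm]
  simp only [mul_assoc]

lemma expect_neg (ρ A U : Op n) : expect ρ (-A) U = -expect ρ A U := by simp [expect]

lemma expect_add (ρ A B U : Op n) : expect ρ (A + B) U = expect ρ A U + expect ρ B U := by
  simp [expect, mul_add]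

lemma expect_smul (ρ : Op n) (a : ℂ) (A U : Op n) : expect ρ (a • A) U = a * expect ρ A U := by
  simp [expect]

lemma expect_sum {ι : Type*} (S : Finset ι) (ρ : Op n) (A : ι → Op n) (U : Op n) :
    expect ρ (∑ i ∈ S, A i) U = ∑ i ∈ S, expect ρ (A i) U := by
  simp [expect, Finset.mul_sum, Matrix.trace_sum]

lemma star_expect {ρ A : Op n} (hρ : ρ.IsHermitian) (hA : A.IsHermitian) (U : Op n) :
    star (expect ρ A U) = expect ρ A U := by
  unfold expect
  rw [← Matrix.trace_conjTranspose, Matrix.conjTranspose_mul, hA, Matrix.trace_mul_comm]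
  simp only [Matrix.conjTranspose_mul, Matrix.conjTranspose_conjTranspose, hρ.eq, mul_assoc]

lemma loss_eq_expect {ρ A : Op n} (hρ : ρ.IsHermitian) (hA : A.IsHermitian) (U : Op n) :
    (loss ρ A U : ℂ) = expect ρ A U :=
  Complex.conj_eq_iff_re.mp (star_expect hρ hA U)

/-- The Haar average of `Tr[g ρ g† A]`. -/
noncomputable def haarMean (ρ A : Op n) : ℂ := ∫ g : matchgateGroup n, expect ρ A g ∂(haarG n)

/-- The Haar average of `Tr[g ρ g† A]^* Tr[g ρ g† B]`. -/
noncomputable def haarForm (ρ A B : Op n) : ℂ :=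
  ∫ g : matchgateGroup n, star (expect ρ A g) * expect ρ B g ∂(haarG n)

lemma haarMean_conj (ρ A : Op n) (h : matchgateGroup n) :
    haarMean ρ ((h : Op n)ᴴ * A * (h : Op n)) = haarMean ρ A := by
  rw [haarMean, haarMean,
    ← integral_mul_left_eq_self (fun g : matchgateGroup n => expect ρ A (g : Op n)) h]
  refine integral_congr_ae (Filter.Eventually.of_forall fun g => ?_)
  exact (expect_mul _ _ _ _).symm

lemma haarForm_conj (ρ A B : Op n) (h : matchgateGroup n) :
    haarForm ρ ((h : Op n)ᴴ * A * (h : Op n)) ((h : Op n)ᴴ * B * (h : Op n))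
      = haarForm ρ A B := by
  rw [haarForm, haarForm, ← integral_mul_left_eq_self
    (fun g : matchgateGroup n => star (expect ρ A (g : Op n)) * expect ρ B (g : Op n)) h]
  refine integral_congr_ae (Filter.Eventually.of_forall fun g => ?_)
  simp only [← expect_mul]
  rfl

lemma haarMean_neg (ρ A : Op n) : haarMean ρ (-A) = -haarMean ρ A := by
  simp only [haarMean, expect_neg, integral_neg]

lemma haarForm_neg_left (ρ A B : Op n) : haarForm ρ (-A) B = -haarForm ρ A B := by
  simp only [haarForm, expect_neg, star_neg, neg_mul, integral_neg]

lemma haarForm_neg_right (ρ A B : Op n) : haarForm ρ A (-B) = -haarForm ρ A B := by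
  simp only [haarForm, expect_neg, mul_neg, integral_neg]

/-- The quarter turn $R$ commutes with $c^s$ if $s$ does not separate $\mu,\nu$. Otherwise
$R^\dagger c^s=c^sR$, so $R^\dagger c^sR=c^sR^2=c^sc_\mu c_\nu$, which is the swapped product up to
sign. -/
lemma exists_rotation {μ ν : Fin (2 * n)} (h : (μ : ℕ) + 1 = ν) :
    ∃ R : matchgateGroup n, ∀ s, SignEq ((R : Op n)ᴴ * majoranaProd n s * (R : Op n))
      (majoranaProd n (s.map (Equiv.swap μ ν).toEmbedding)) := by
  obtain ⟨R, hsq, a, hR⟩ := exists_mem_matchgateGroup_rotation h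
  have hne : μ ≠ ν := by rintro rfl; omega
  refine ⟨R, fun s => ?_⟩
  by_cases hs : μ ∈ s ↔ ν ∈ s
  · have hc : (R : Op n) * majoranaProd n s = majoranaProd n s * (R : Op n) := by
      rw [hR, Matrix.smul_mul, Matrix.mul_smul, add_mul, mul_add, one_mul, mul_one,
        majoranaPair_mul_of_mem_iff hs]
    rw [map_swap_of_mem_iff hs, mul_assoc, ← hc, ← mul_assoc, matchgateGroup_conjTranspose_mul,
      one_mul]
    exact SignEq.refl _
  · refine SignEq.trans ?_ (signEq_majoranaProd_map_swap hs).symm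
    have hc : (R : Op n)ᴴ * majoranaProd n s = majoranaProd n s * (R : Op n) := by
      rw [hR, Matrix.conjTranspose_smul, Matrix.smul_mul, Matrix.mul_smul,
        Matrix.conjTranspose_add, Matrix.conjTranspose_one, majoranaPair_conjTranspose hne,
        add_mul, mul_add, one_mul, mul_one, neg_mul, majoranaPair_mul_of_not_mem_iff hs, neg_neg,
        Complex.star_def, Complex.conj_ofReal]
    rw [hc, mul_assoc, hsq, majoranaPair_mul_of_not_mem_iff hs]
    exact Or.inr (neg_neg _).symm

lemma exists_half_turn {μ ν : Fin (2 * n)} (h : (μ : ℕ) + 1 = ν) :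
    ∃ R : matchgateGroup n, ∀ s, (R : Op n)ᴴ * majoranaProd n s * (R : Op n)
      = if μ ∈ s ↔ ν ∈ s then majoranaProd n s else -majoranaProd n s := by
  obtain ⟨R, hsq, -⟩ := exists_mem_matchgateGroup_rotation h
  have hne : μ ≠ ν := by rintro rfl; omega
  have hp := majoranaPair_mul_self hne
  have hsq' : ((R * R : matchgateGroup n) : Op n) = majoranaPair n μ ν := hsq
  refine ⟨R * R, fun s => ?_⟩
  rw [hsq', majoranaPair_conjTranspose hne]
  split_ifs with hs
  · rw [mul_assoc, ← majoranaPair_mul_of_mem_iff hs, ← mul_assoc, neg_mul, hp, neg_neg, one_mul]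
  · rw [neg_mul, majoranaPair_mul_of_not_mem_iff hs, neg_neg, mul_assoc, hp, mul_neg, mul_one]

lemma haarMean_majoranaProd {κ : ℕ} (hκ0 : 0 < κ) (hκ : κ < 2 * n) (ρ : Op n)
    {s : Finset (Fin (2 * n))} (hs : s.card = κ) : haarMean ρ (majoranaProd n s) = 0 := by
  obtain ⟨μ, ν, hμν, hc⟩ := exists_adjacent_crossing (d := s)
    (Finset.card_pos.mp (hs ▸ hκ0)) (by rintro rfl; simp at hs; omega)
  obtain ⟨R, hR⟩ := exists_half_turn hμν
  have h := haarMean_conj ρ (majoranaProd n s) R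
  rw [hR, if_neg hc, haarMean_neg] at h
  exact self_eq_neg.mp h.symm

lemma haarForm_majoranaProd_of_ne {κ : ℕ} (hκn : κ ≠ n) (ρ : Op n)
    {s t : Finset (Fin (2 * n))} (hs : s.card = κ) (ht : t.card = κ) (hst : s ≠ t) :
    haarForm ρ (majoranaProd n s) (majoranaProd n t) = 0 := by
  -- A pair separated by $s\mathbin{\triangle}t$ is separated by exactly one of $s$ and $t$, so the
  -- half turn negates just one argument of the form.
  obtain ⟨μ, ν, hμν, hc⟩ := exists_adjacent_crossing (d := symmDiff s t)
    (Finset.nonempty_iff_ne_empty.mpr (by simpa using hst)) (by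
      intro h
      have ht' : t = sᶜ := by
        ext x
        have : x ∈ symmDiff s t := by rw [h]; exact Finset.mem_univ x
        rw [Finset.mem_symmDiff] at this
        rw [Finset.mem_compl]
        tauto
      rw [ht', Finset.card_compl, Fintype.card_fin, hs] at ht
      omega)
  obtain ⟨R, hR⟩ := exists_half_turn hμν
  have h := haarForm_conj ρ (majoranaProd n s) (majoranaProd n t) R
  rw [hR, hR] at h
  simp only [Finset.mem_symmDiff] at hc
  by_cases h1 : μ ∈ s ↔ ν ∈ s
  · have h2 : ¬(μ ∈ t ↔ ν ∈ t) := by tauto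
    rw [if_pos h1, if_neg h2, haarForm_neg_right] at h
    exact self_eq_neg.mp h.symm
  · have h2 : μ ∈ t ↔ ν ∈ t := by tauto
    rw [if_neg h1, if_pos h2, haarForm_neg_left] at h
    exact self_eq_neg.mp h.symm

lemma haarForm_majoranaProd_self_eq (ρ : Op n) {s t : Finset (Fin (2 * n))}
    (hst : s.card = t.card) :
    haarForm ρ (majoranaProd n s) (majoranaProd n s)
      = haarForm ρ (majoranaProd n t) (majoranaProd n t) := by
  refine eq_of_forall_adjacent_swap
    (f := fun s => haarForm ρ (majoranaProd n s) (majoranaProd n s)) ?_ hst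
  intro μ ν hμν s
  obtain ⟨R, hR⟩ := exists_rotation hμν
  rw [← haarForm_conj ρ (majoranaProd n s) _ R]
  rcases hR s with h | h
  · rw [h]
  · rw [h, haarForm_neg_left, haarForm_neg_right, neg_neg]

/-- By Parseval the summed integrand is $2^n\mathcal P_\kappa(g\rho g^\dagger)$, which does not
depend on $g$. -/
lemma sum_haarForm_majoranaProd_self (κ : ℕ) {ρ : Op n} (hρ : ρ.IsHermitian) :
    ∑ s ∈ Finset.powersetCard κ Finset.univ, haarForm ρ (majoranaProd n s) (majoranaProd n s)
      = ((2 ^ n * purity κ ρ : ℝ) : ℂ) := by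
  unfold haarForm
  rw [← integral_finsetSum]
  · have h : ∀ g : matchgateGroup n, ∑ s ∈ Finset.powersetCard κ Finset.univ,
        star (expect ρ (majoranaProd n s) g) * expect ρ (majoranaProd n s) g
        = ((2 ^ n * purity κ ρ : ℝ) : ℂ) := by
      intro g
      rw [← purity_conj κ g ρ, purity_eq_sum]
      push_cast
      refine Finset.sum_congr rfl fun s _ => ?_
      have hg : ((g : Op n) * ρ * (g : Op n)ᴴ)ᴴ = (g : Op n) * ρ * (g : Op n)ᴴ := by
        simp [Matrix.conjTranspose_mul, hρ.eq, mul_assoc]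
      have : ((majoranaProd n s)ᴴ * ((g : Op n) * ρ * (g : Op n)ᴴ)).trace
          = star (expect ρ (majoranaProd n s) g) := by
        rw [expect, ← Matrix.trace_conjTranspose, Matrix.conjTranspose_mul, hg]
      rw [this, norm_star, Complex.star_def, Complex.conj_mul']
    rw [integral_congr_ae (Filter.Eventually.of_forall h)]
    simp
  · intro s _
    exact integrable_haarG (φ := fun U => star (expect ρ (majoranaProd n s) U) *
      expect ρ (majoranaProd n s) U)
      ((continuous_expect _ _).star.mul (continuous_expect _ _))

lemma haarMean_eq_zero {κ : ℕ} (hκ0 : 0 < κ) (hκ : κ < 2 * n) (ρ : Op n) {A : Op n}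
    (hA : A ∈ majoranaModule n κ) : haarMean ρ A = 0 := by
  induction hA using Submodule.span_induction with
  | mem A hA =>
    obtain ⟨s, hs, rfl⟩ := hA
    exact haarMean_majoranaProd hκ0 hκ ρ hs
  | zero => simp [haarMean, expect]
  | add A B _ _ hA hB =>
    simp only [haarMean, expect_add] at hA hB ⊢
    rw [integral_add (integrable_haarG (continuous_expect _ _))
      (integrable_haarG (continuous_expect _ _)), hA, hB, add_zero]
  | smul a A _ hA =>
    simp only [haarMean, expect_smul] at hA ⊢
    rw [integral_const_mul, hA, mul_zero]

lemma haarForm_sum_sum {ι : Type*} (S : Finset ι) (ρ : Op n) (a : ι → ℂ) (A : ι → Op n) :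
    haarForm ρ (∑ i ∈ S, a i • A i) (∑ i ∈ S, a i • A i)
      = ∑ i ∈ S, ∑ j ∈ S, star (a i) * a j * haarForm ρ (A i) (A j) := by
  have hint : ∀ i j, Integrable (fun g : matchgateGroup n =>
      star (a i) * a j * (star (expect ρ (A i) g) * expect ρ (A j) g)) (haarG n) := fun i j =>
    integrable_haarG (φ := fun U => star (a i) * a j * (star (expect ρ (A i) U) *
      expect ρ (A j) U)) (continuous_const.mul
      ((continuous_expect _ _).star.mul (continuous_expect _ _)))
  simp only [haarForm, ← integral_const_mul]
  simp only [← integral_finsetSum _ fun j _ => hint _ j]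
  rw [← integral_finsetSum _ fun i _ => integrable_finsetSum _ fun j _ => hint i j]
  refine integral_congr_ae (Filter.Eventually.of_forall fun g => ?_)
  simp only [expect_sum, expect_smul, star_sum, Finset.sum_mul_sum, star_mul']
  refine Finset.sum_congr rfl fun i _ => Finset.sum_congr rfl fun j _ => ?_
  ring

/-- The second moment over the group. -/
lemma choose_mul_haarForm {κ : ℕ} (hκn : κ ≠ n) {ρ A : Op n} (hρ : ρ.IsHermitian)
    (hA : A ∈ majoranaModule n κ) :
    ((2 * n).choose κ : ℂ) * haarForm ρ A A = ((purity κ ρ * purity κ A : ℝ) : ℂ) := by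
  set S := Finset.powersetCard κ (Finset.univ : Finset (Fin (2 * n))) with hS
  set a : Finset (Fin (2 * n)) → ℂ := fun s => ((2 : ℂ) ^ n)⁻¹ * ((majoranaProd n s)ᴴ * A).trace
    with ha
  have hA' : A = ∑ s ∈ S, a s • majoranaProd n s := (component_eq_self hA).symm
  have h1 : haarForm ρ A A
      = ∑ s ∈ S, star (a s) * a s * haarForm ρ (majoranaProd n s) (majoranaProd n s) := by
    conv_lhs => rw [hA']
    rw [haarForm_sum_sum]
    refine Finset.sum_congr rfl fun s hs => ?_
    refine Finset.sum_eq_single_of_mem s hs fun t ht hts => ?_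
    rw [haarForm_majoranaProd_of_ne hκn ρ (Finset.mem_powersetCard_univ.mp hs)
      (Finset.mem_powersetCard_univ.mp ht) hts.symm, mul_zero]
  -- The $\binom{2n}{\kappa}$ diagonal entries are equal and their sum is known.
  have hdiag : ∀ s ∈ S, ((2 * n).choose κ : ℂ) *
      haarForm ρ (majoranaProd n s) (majoranaProd n s) = ((2 ^ n * purity κ ρ : ℝ) : ℂ) := by
    intro s hs
    rw [← sum_haarForm_majoranaProd_self κ hρ, Finset.sum_congr rfl fun t ht =>
      haarForm_majoranaProd_self_eq ρ ((Finset.mem_powersetCard_univ.mp ht).trans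
        (Finset.mem_powersetCard_univ.mp hs).symm), Finset.sum_const, Finset.card_powersetCard]
    simp
  have hP : ((2 ^ n * purity κ A : ℝ) : ℂ) = ∑ s ∈ S, 2 ^ n * 2 ^ n * (star (a s) * a s) := by
    rw [purity_eq_sum]
    push_cast
    refine Finset.sum_congr rfl fun s _ => ?_
    rw [← Complex.conj_mul']
    simp only [ha, star_mul', star_inv₀, star_pow, Complex.star_def, map_ofNat]
    field_simp
  rw [h1, Finset.mul_sum]
  calc _ = ∑ s ∈ S, star (a s) * a s * ((2 ^ n * purity κ ρ : ℝ) : ℂ) := by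
        refine Finset.sum_congr rfl fun s hs => ?_
        rw [← hdiag s hs]; ring
    _ = (2 ^ n)⁻¹ * ((2 ^ n * purity κ A : ℝ) : ℂ) * purity κ ρ := by
        rw [hP, Finset.mul_sum, Finset.sum_mul]
        refine Finset.sum_congr rfl fun s hs => ?_
        push_cast
        field_simp
    _ = _ := by push_cast; field_simp

end Haar

/-! ### Unitarity and continuity of the circuit -/

section Circuit

variable {n L : ℕ}

lemma exists_gate_eq {H : Op n} (hH : H ∈ generators n) :
    ∃ g : Op n, g * g = -1 ∧ gᴴ = -g ∧
      ∀ x : ℝ, -(Complex.I * (x : ℂ)) • H = ((-x : ℝ) : ℂ) • g := by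
  obtain ⟨μ, ν, hμν, e⟩ := exists_majoranaPair_of_generator hH
  have hne : μ ≠ ν := by rintro rfl; omega
  refine ⟨_, majoranaPair_mul_self hne, majoranaPair_conjTranspose hne, fun x => ?_⟩
  rw [← e, smul_smul]
  push_cast
  ring_nf

lemma circuit_mem_unitaryGroup {H : Fin L → Op n} (hH : ∀ l, H l ∈ generators n)
    (θ : Fin L → ℝ) : circuit H θ ∈ Matrix.unitaryGroup (Basis n) ℂ := by
  refine Submonoid.list_prod_mem _ fun A hA => ?_
  obtain ⟨l, rfl⟩ := (List.mem_ofFn' _ _).mp hA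
  obtain ⟨g, hg, hg', e⟩ := exists_gate_eq (hH l)
  simp only [e]
  exact exp_smul_mem_unitaryGroup hg hg' _

lemma continuous_circuit {H : Fin L → Op n} (hH : ∀ l, H l ∈ generators n) :
    Continuous (circuit H) := by
  unfold circuit
  simp only [List.ofFn_eq_map]
  refine continuous_list_prod _ fun l _ => ?_
  obtain ⟨g, hg, -, e⟩ := exists_gate_eq (hH l)
  simp only [e, exp_smul_of_mul_self_eq_neg_one hg]
  fun_prop

end Circuit

/-! ### From the design to Haar moments -/

section Transfer

variable {n : ℕ}

lemma integral_trace_mul {ι Θ : Type*} [Fintype ι] [MeasurableSpace Θ] {m : Measure Θ}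
    {X : Θ → Matrix ι ι ℂ} (hX : ∀ i j, Integrable (fun θ => X θ i j) m) (B : Matrix ι ι ℂ) :
    ∫ θ, (X θ * B).trace ∂m = ∑ i, ∑ j, (∫ θ, X θ i j ∂m) * B j i := by
  simp only [Matrix.trace, Matrix.diag_apply, Matrix.mul_apply]
  rw [integral_finsetSum _ fun i _ => integrable_finsetSum _ fun j _ => (hX i j).mul_const _]
  refine Finset.sum_congr rfl fun i _ => ?_
  rw [integral_finsetSum _ fun j _ => (hX i j).mul_const _]
  simp only [integral_mul_const]

/-- The trace is multiplicative on Kronecker products, so the square is linear in the conjugate of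
$\rho\otimes\rho$ by $U\otimes U$, which the design condition for $t=2$ controls. -/
lemma expect_sq (ρ A U : Op n) :
    expect ρ A U ^ 2 = ((U ⊗ₖ U) * (ρ ⊗ₖ ρ) * (U ⊗ₖ U)ᴴ * (A ⊗ₖ A)).trace := by
  rw [Matrix.conjTranspose_kronecker, ← Matrix.mul_kronecker_mul, ← Matrix.mul_kronecker_mul,
    ← Matrix.mul_kronecker_mul, Matrix.trace_kronecker, expect, sq]

variable {Θ : Type*} [TopologicalSpace Θ] [MeasurableSpace Θ] [OpensMeasurableSpace Θ]
  {m : Measure Θ} [IsFiniteMeasure m] {u : Θ → Op n}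

lemma IsTwoDesign.integral_expect (hd : IsTwoDesign m u) (hu : Continuous u)
    (hU : ∀ θ, u θ ∈ Matrix.unitaryGroup (Basis n) ℂ) (ρ A : Op n) :
    ∫ θ, expect ρ A (u θ) ∂m = haarMean ρ A := by
  have hφ : ∀ i j, Continuous fun U : Op n => (U * ρ * Uᴴ) i j := fun i j => by fun_prop
  unfold haarMean expect
  rw [integral_trace_mul fun i j => integrable_comp_unitary hu hU (hφ i j),
    integral_trace_mul fun i j => integrable_haarG (hφ i j)]
  simp only [hd.1]

lemma IsTwoDesign.integral_expect_sq (hd : IsTwoDesign m u) (hu : Continuous u)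
    (hU : ∀ θ, u θ ∈ Matrix.unitaryGroup (Basis n) ℂ) {ρ A : Op n} (hρ : ρ.IsHermitian)
    (hA : A.IsHermitian) :
    ∫ θ, expect ρ A (u θ) ^ 2 ∂m = haarForm ρ A A := by
  have hφ : ∀ i j, Continuous fun U : Op n =>
      ((U ⊗ₖ U) * (ρ ⊗ₖ ρ) * (U ⊗ₖ U)ᴴ) i j := fun i j => by
    have hk : Continuous fun U : Op n => U ⊗ₖ U := by
      refine continuous_matrix fun i j => ?_
      simp only [Matrix.kroneckerMap_apply]
      fun_prop
    fun_prop
  unfold haarForm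
  simp only [star_expect hρ hA, ← sq, expect_sq]
  rw [integral_trace_mul fun i j => integrable_comp_unitary hu hU (hφ i j),
    integral_trace_mul fun i j => integrable_haarG (hφ i j)]
  simp only [hd.2]

end Transfer

end Matchgate

theorem corollary1 (n κ : ℕ) (hκ0 : 0 < κ) (hκ2n : κ < 2 * n) (hκn : κ ≠ n)
    (L : ℕ) (H : Fin L → Matchgate.Op n) (hH : ∀ l, H l ∈ Matchgate.generators n)
    (μ : MeasureTheory.Measure (Fin L → ℝ)) [MeasureTheory.IsProbabilityMeasure μ]
    (hdesign : Matchgate.IsTwoDesign μ (Matchgate.circuit H))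
    (ρ O : Matchgate.Op n) (hρ : Matchgate.IsState ρ) (hO : O.IsHermitian)
    (hOκ : O ∈ Matchgate.majoranaModule n κ) :
    ProbabilityTheory.variance (fun θ => Matchgate.loss ρ O (Matchgate.circuit H θ)) μ
        = Matchgate.purity κ ρ * Matchgate.purity κ O
            / (Module.finrank ℂ (Matchgate.majoranaModule n κ) : ℝ)
      ∧ Module.finrank ℂ (Matchgate.majoranaModule n κ) = (2 * n).choose κ := by
  have hρ' : ρ.IsHermitian := hρ.1.isHermitian
  have hu := Matchgate.continuous_circuit hH
  have hU := Matchgate.circuit_mem_unitaryGroup hH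
  have hfin := Matchgate.finrank_majoranaModule n κ
  refine ⟨?_, hfin⟩
  have hcont : Continuous (Matchgate.loss ρ O) :=
    Complex.continuous_re.comp (Matchgate.continuous_expect ρ O)
  have hmem : MemLp (fun θ => Matchgate.loss ρ O (Matchgate.circuit H θ)) 2 μ := by
    obtain ⟨C, hC⟩ :=
      (Matchgate.isCompact_unitaryGroup n).exists_bound_of_continuousOn hcont.continuousOn
    exact MemLp.of_bound (hcont.comp hu).aestronglyMeasurable C
      (Filter.Eventually.of_forall fun θ => hC _ (hU θ))
  have hmean : ∫ θ, Matchgate.loss ρ O (Matchgate.circuit H θ) ∂μ = 0 := by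
    have h := hdesign.integral_expect hu hU ρ O
    rw [Matchgate.haarMean_eq_zero hκ0 hκ2n ρ hOκ] at h
    simp only [← Matchgate.loss_eq_expect hρ' hO] at h
    rw [integral_complex_ofReal] at h
    exact_mod_cast h
  have hsq : ((2 * n).choose κ : ℝ) * ∫ θ, Matchgate.loss ρ O (Matchgate.circuit H θ) ^ 2 ∂μ
      = Matchgate.purity κ ρ * Matchgate.purity κ O := by
    have h := hdesign.integral_expect_sq hu hU hρ' hO
    simp only [← Matchgate.loss_eq_expect hρ' hO, ← Complex.ofReal_pow] at h
    rw [integral_complex_ofReal] at h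
    have h' := Matchgate.choose_mul_haarForm hκn hρ' hOκ
    rw [← h] at h'
    exact_mod_cast h'
  have hpos : ((2 * n).choose κ : ℝ) ≠ 0 := by
    exact_mod_cast (Nat.choose_pos hκ2n.le).ne'
  -- The mean is zero, so the variance is the second moment.
  rw [ProbabilityTheory.variance_eq_sub hmem, hfin, eq_div_iff hpos, hmean, ← hsq]
  simp only [Pi.pow_apply]
  ring
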